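/- Let $N\ge 1$ be an integer and let $a>-1$ be real. Let $R$ be a random $N\times N$ real correlation matrix (a real symmetric positive definite matrix with all diagonal entries equal to $1$) whose distribution has probability density function $$P(R)=\frac{1}{C_{a,N}}(\det R)^a$$ with respect to Lebesgue measure in the $N(N-1)/2$ entries strictly below the diagonal, restricted to the set of correlation matrices, where $C_{a,N}$ is the normalisation (which is finite and positive, so that this is a probability distribution). Write $B(\alpha,\beta)=\Gamma(\alpha)\Gamma(\beta)/\Gamma(\alpha+\beta)$ for the beta function and $\Psi=\Gamma'/\Gamma$ for the digamma function. Then for every real $s$ with $a+s>-1$ the random variable $(\det R)^s$ is integrable and $$\mathbb E\big[(\det R)^s\big]=\prod_{j=1}^{N-1}\left(\frac{B\left(a+s+\frac{j+1}{2},\frac12\right)}{B\left(a+\frac{j+1}{2},\frac12\right)}\right)^{j}.$$ Moreover $\log\det R$ is integrable and $$\mathbb E[\log\det R]=\sum_{j=1}^{N-1}j\left(\Psi\left(a+\frac{j+1}{2}\right)-\Psi\left(a+1+\frac j2\right)\right).$$ -/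

import Mathlib

open MeasureTheory

noncomputable section

/-- The positions `(j, k)` with `k < j` strictly below the diagonal of an `N × N` matrix. -/
abbrev LowerIndex (N : ℕ) : Type := {p : Fin N × Fin N // p.2 < p.1}

/-- The real symmetric matrix with unit diagonal whose entries strictly below the diagonal are
`ρ`. -/
def corrMatrix {N : ℕ} (ρ : LowerIndex N → ℝ) : Matrix (Fin N) (Fin N) ℝ :=
  Matrix.of fun j k =>
    if h : k < j then ρ ⟨(j, k), h⟩
    else if h' : j < k then ρ ⟨(k, j), h'⟩
    else 1

/-- The space of `N × N` real correlation matrices (positive definite, unit diagonal),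
in the coordinates given by the entries strictly below the diagonal. -/
def elliptope (N : ℕ) : Set (LowerIndex N → ℝ) :=
  {ρ | (corrMatrix ρ).PosDef}

/-- The normalisation `C_{a,N} = ∫ (det R)^a dR` over the space of correlation matrices, where
`dR` is Lebesgue measure in the entries strictly below the diagonal. -/
def corrNorm (N : ℕ) (a : ℝ) : ℝ :=
  ∫ ρ in elliptope N, (corrMatrix ρ).det ^ a

/-- The distribution on correlation matrices with density `(det R)^a / C_{a,N}`. -/
def corrMeasure (N : ℕ) (a : ℝ) : Measure (LowerIndex N → ℝ) :=
  (volume.restrict (elliptope N)).withDensity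
    fun ρ => ENNReal.ofReal (1 / corrNorm N a * (corrMatrix ρ).det ^ a)

end

/-! Let Z_N(b) be the integral of (det R)^b over N × N correlation matrices. Bordering R by a last
row r multiplies the determinant by the Schur complement 1 - rᵀR⁻¹r, and the bordered matrix is
positive definite exactly when R is and this factor is positive. Substituting r = Mu with R = MMᵀ
turns the integral over r into √(det R) times a unit-ball integral, a product of beta values. Hence
Z_{N+1}(b) = Z_N(b + 1/2) · `ballBeta N b`, and induction gives `lintegral_elliptope_truncPow_det`.

Working with `truncPow` in `ℝ≥0∞` encodes the domain in the integrand and leaves Tonelli free of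
integrability conditions; finiteness comes with the value.

The moments are the ratios Z_N(a + s) / Z_N(a). They are also the moment generating function of log
det R, so its derivative at 0 is the mean of the logarithm. -/

/-! ### Truncated powers and one-dimensional beta integrals. -/

/-- The power `t ^ b`, truncated to zero for `t ≤ 0`, with values in `ℝ≥0∞`. -/
noncomputable def truncPow (b t : ℝ) : ENNReal := if 0 < t then ENNReal.ofReal (t ^ b) else 0

theorem measurable_truncPow (b : ℝ) : Measurable (truncPow b) :=
  Measurable.ite measurableSet_Ioi (by fun_prop) measurable_const

theorem truncPow_of_nonpos (b : ℝ) {t : ℝ} (ht : t ≤ 0) : truncPow b t = 0 := by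
  simp [truncPow, ht]

theorem truncPow_of_pos (b : ℝ) {t : ℝ} (ht : 0 < t) : truncPow b t = ENNReal.ofReal (t ^ b) := by
  simp [truncPow, ht]

theorem truncPow_mul (b : ℝ) {t : ℝ} (ht : 0 < t) (s : ℝ) :
    truncPow b (t * s) = ENNReal.ofReal (t ^ b) * truncPow b s := by
  rcases le_or_gt s 0 with hs | hs
  · rw [truncPow_of_nonpos b hs, truncPow_of_nonpos b (mul_nonpos_of_nonneg_of_nonpos ht.le hs),
      mul_zero]
  · rw [truncPow_of_pos b hs, truncPow_of_pos b (mul_pos ht hs), Real.mul_rpow ht.le hs.le,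
      ENNReal.ofReal_mul (by positivity)]

theorem lintegral_comp_mul_left_real {c : ℝ} (hc : 0 < c) {f : ℝ → ENNReal} (hf : Measurable f) :
    ∫⁻ x, f x = ENNReal.ofReal c * ∫⁻ x, f (c * x) := by
  conv_lhs => rw [← Real.smul_map_volume_mul_left hc.ne']
  rw [lintegral_smul_measure, lintegral_map hf (by fun_prop), abs_of_pos hc, smul_eq_mul]

/-- This is Legendre's duplication formula, divided through by Γ(2s)Γ(s + 1/2). -/
theorem beta_self_eq {s : ℝ} (hs : 0 < s) :
    (2 : ℝ) ^ (2 * s - 1) * ProbabilityTheory.beta s s = ProbabilityTheory.beta s (1 / 2) := by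
  have h := Real.Gamma_mul_Gamma_add_half s
  have h1 := (Real.Gamma_pos_of_pos hs).ne'
  have h2 := (Real.Gamma_pos_of_pos (show 0 < s + 1 / 2 by positivity)).ne'
  have h3 := (Real.Gamma_pos_of_pos (show 0 < 2 * s by positivity)).ne'
  have h4 : (2 : ℝ) ^ (1 - 2 * s) * 2 ^ (2 * s - 1) = 1 := by
    rw [← Real.rpow_add two_pos]; simp
  rw [ProbabilityTheory.beta, ProbabilityTheory.beta, Real.Gamma_one_half_eq, ← two_mul]
  rw [mul_div_assoc', div_eq_div_iff h3 h2]
  linear_combination (2 : ℝ) ^ (2 * s - 1) * Real.Gamma s * h +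
    Real.Gamma s * (Real.Gamma (2 * s) * √Real.pi) * h4

theorem lintegral_truncPow_one_sub_sq {b : ℝ} (hb : -1 < b) :
    ∫⁻ x : ℝ, truncPow b (1 - x ^ 2) = ENNReal.ofReal (ProbabilityTheory.beta (b + 1) (1 / 2)) := by
  have hb' : 0 < b + 1 := by linarith
  have hB := ProbabilityTheory.beta_pos hb' hb'
  have hm : Measurable fun x : ℝ => truncPow b (1 - x ^ 2) :=
    (measurable_truncPow b).comp (by fun_prop)
  have key : ∀ x : ℝ, truncPow b (1 - (2 * x - 1) ^ 2) =
      ENNReal.ofReal (4 ^ b * ProbabilityTheory.beta (b + 1) (b + 1)) *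
        ProbabilityTheory.betaPDF (b + 1) (b + 1) x := by
    intro x
    have e : 1 - (2 * x - 1) ^ 2 = 4 * (x * (1 - x)) := by ring
    rw [e, truncPow_mul b (by norm_num)]
    by_cases hx : 0 < x ∧ x < 1
    · obtain ⟨h0, h1⟩ := hx
      have h1' : 0 < 1 - x := by linarith
      rw [truncPow_of_pos b (by positivity), ProbabilityTheory.betaPDF_of_pos_lt_one h0 h1,
        ← ENNReal.ofReal_mul (by positivity), ← ENNReal.ofReal_mul (by positivity)]
      congr 1
      rw [Real.mul_rpow h0.le h1'.le, add_sub_cancel_right]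
      field_simp
    · rw [truncPow_of_nonpos, ProbabilityTheory.betaPDF_eq, if_neg hx]
      · simp
      · by_contra! h
        rcases pos_and_pos_or_neg_and_neg_of_mul_pos h with h | h
        · exact hx ⟨h.1, by linarith [h.2]⟩
        · linarith [h.1, h.2]
  -- The affine change of variable to 2x - 1 carries (0, 1) onto (-1, 1) and exposes the symmetric
  -- beta density of `key`.
  rw [← lintegral_sub_right_eq_self _ (1 : ℝ), lintegral_comp_mul_left_real two_pos
    (f := fun x => truncPow b (1 - (x - 1) ^ 2)) (hm.comp (measurable_id.sub_const 1))]
  simp only [key]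
  rw [lintegral_const_mul' _ _ ENNReal.ofReal_ne_top,
    ProbabilityTheory.lintegral_betaPDF_eq_one hb' hb', mul_one,
    ← ENNReal.ofReal_mul two_pos.le, ← beta_self_eq hb']
  congr 1
  rw [show (4 : ℝ) = 2 ^ (2 : ℝ) by norm_num, ← Real.rpow_mul two_pos.le, ← mul_assoc,
    show 2 * (b + 1) - 1 = 1 + 2 * b by ring, Real.rpow_add two_pos, Real.rpow_one]

/-- Rescaling x by √t contributes t^b from the integrand and t^(1/2) from the Jacobian; this is the
source of every half-integer shift below. -/
theorem lintegral_truncPow_sub_sq {b : ℝ} (hb : -1 < b) (t : ℝ) :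
    ∫⁻ x : ℝ, truncPow b (t - x ^ 2) =
      truncPow (b + 1 / 2) t * ENNReal.ofReal (ProbabilityTheory.beta (b + 1) (1 / 2)) := by
  rcases le_or_gt t 0 with ht | ht
  · rw [truncPow_of_nonpos _ ht, zero_mul]
    simp [fun x : ℝ => truncPow_of_nonpos b (show t - x ^ 2 ≤ 0 by nlinarith [sq_nonneg x])]
  · rw [lintegral_comp_mul_left_real (Real.sqrt_pos.2 ht) (f := fun x => truncPow b (t - x ^ 2))
      ((measurable_truncPow b).comp (by fun_prop)), truncPow_of_pos _ ht]
    have e (x : ℝ) : t - (√t * x) ^ 2 = t * (1 - x ^ 2) := by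
      rw [mul_pow, Real.sq_sqrt ht.le]; ring
    simp only [e, truncPow_mul b ht]
    rw [lintegral_const_mul' _ _ ENNReal.ofReal_ne_top, lintegral_truncPow_one_sub_sq hb,
      ← mul_assoc, ← ENNReal.ofReal_mul (by positivity), Real.rpow_add ht, ← Real.sqrt_eq_rpow,
      mul_comm (√t)]

/-! ### Integrals over balls and ellipsoids. -/

/-- The value of `∫ (1 - ‖u‖²) ^ b` over the unit ball of `ℝⁿ`. -/
noncomputable def ballBeta (n : ℕ) (b : ℝ) : ℝ :=
  ∏ j ∈ Finset.range n, ProbabilityTheory.beta (b + 1 + (j : ℝ) / 2) (1 / 2)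

theorem ballBeta_pos (n : ℕ) {b : ℝ} (hb : -1 < b) : 0 < ballBeta n b :=
  Finset.prod_pos fun j _ => ProbabilityTheory.beta_pos
    (add_pos_of_pos_of_nonneg (by linarith) (by positivity)) (by norm_num)

theorem ballBeta_succ (n : ℕ) (b : ℝ) :
    ballBeta (n + 1) b =
      ballBeta n (b + 1 / 2) * ProbabilityTheory.beta (b + 1) (1 / 2) := by
  rw [ballBeta, Finset.prod_range_succ', ballBeta]
  congr 1
  · refine Finset.prod_congr rfl fun j _ => ?_
    congr 1
    push_cast
    ring
  · simp

/-- Integrating out one coordinate first leaves the same integral in one dimension less, with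
exponent b + 1/2; hence b is generalised in the induction. -/
theorem lintegral_truncPow_one_sub_sum_sq (n : ℕ) {b : ℝ} (hb : -1 < b) :
    ∫⁻ u : Fin n → ℝ, truncPow b (1 - ∑ i, u i ^ 2) = ENNReal.ofReal (ballBeta n b) := by
  induction n generalizing b with
  | zero =>
    simp [ballBeta, truncPow, volume_pi]
  | succ n ih =>
    have hm : Measurable fun u : Fin (n + 1) → ℝ => truncPow b (1 - ∑ i, u i ^ 2) :=
      (measurable_truncPow b).comp (by fun_prop)
    rw [← ((volume_preserving_piFinSuccAbove (fun _ : Fin (n + 1) => ℝ) 0).symm).lintegral_comp hm,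
      Measure.volume_eq_prod, lintegral_prod_symm _ (by
        exact (hm.comp (MeasurableEquiv.measurable _)).aemeasurable)]
    have e (x : ℝ) (v : Fin n → ℝ) :
        1 - ∑ i, ((MeasurableEquiv.piFinSuccAbove (fun _ : Fin (n + 1) => ℝ) 0).symm (x, v)) i ^ 2
          = (1 - ∑ i, v i ^ 2) - x ^ 2 := by
      simp [Fin.sum_univ_succ, MeasurableEquiv.piFinSuccAbove_symm_apply]
      ring
    simp only [e, lintegral_truncPow_sub_sq hb]
    rw [lintegral_mul_const' _ _ ENNReal.ofReal_ne_top, ih (by linarith), ballBeta_succ,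
      ENNReal.ofReal_mul (ballBeta_pos n (by linarith)).le]

open Matrix in
theorem Matrix.PosDef.exists_mul_transpose {n : Type*} [Fintype n] [DecidableEq n]
    {A : Matrix n n ℝ} (hA : A.PosDef) : ∃ M : Matrix n n ℝ, A = M * Mᵀ ∧ M.det ≠ 0 := by
  open scoped MatrixOrder in
  obtain ⟨B, hB⟩ := CStarAlgebra.nonneg_iff_eq_star_mul_self.mp hA.posSemidef.nonneg
  have h : A = Bᵀ * Bᵀᵀ := by
    rw [hB, star_eq_conjTranspose, conjTranspose_eq_transpose_of_trivial, transpose_transpose]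
  refine ⟨Bᵀ, h, fun h0 => hA.det_pos.ne' ?_⟩
  rw [h, det_mul, h0, zero_mul]

open Matrix in
theorem lintegral_comp_mulVec {n : Type*} [Fintype n] [DecidableEq n] {M : Matrix n n ℝ}
    (hM : M.det ≠ 0) {f : (n → ℝ) → ENNReal} (hf : Measurable f) :
    ∫⁻ r, f r = ENNReal.ofReal |M.det| * ∫⁻ u, f (M *ᵥ u) := by
  have h : (volume : Measure (n → ℝ)) =
      ENNReal.ofReal |M.det| • Measure.map (toLin' M) volume := by
    rw [Real.map_matrix_volume_pi_eq_smul_volume_pi hM, smul_smul,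
      ← ENNReal.ofReal_mul (abs_nonneg _), ← abs_mul, mul_inv_cancel₀ hM, abs_one,
      ENNReal.ofReal_one, one_smul]
  conv_lhs => rw [h]
  rw [lintegral_smul_measure, lintegral_map hf (LinearMap.continuous_of_finiteDimensional
    (toLin' M)).measurable, smul_eq_mul]
  simp

open Matrix in
theorem lintegral_truncPow_one_sub_quadratic {n : ℕ} {A : Matrix (Fin n) (Fin n) ℝ}
    (hA : A.PosDef) {b : ℝ} (hb : -1 < b) :
    ∫⁻ r : Fin n → ℝ, truncPow b (1 - r ⬝ᵥ A⁻¹ *ᵥ r) =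
      ENNReal.ofReal (√A.det * ballBeta n b) := by
  obtain ⟨M, rfl, hM⟩ := hA.exists_mul_transpose
  have hu : IsUnit M.det := hM.isUnit
  have hf : Measurable fun r : Fin n → ℝ => truncPow b (1 - r ⬝ᵥ (M * Mᵀ)⁻¹ *ᵥ r) :=
    (measurable_truncPow b).comp (Continuous.measurable (by fun_prop))
  have e (u : Fin n → ℝ) : (M *ᵥ u) ⬝ᵥ (M * Mᵀ)⁻¹ *ᵥ (M *ᵥ u) = ∑ i, u i ^ 2 := by
    -- In the coordinates u the quadratic form becomes the squared Euclidean norm.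
    have h : Mᵀ * (M * Mᵀ)⁻¹ * M = 1 := by
      rw [Matrix.mul_inv_rev, ← Matrix.mul_assoc, mul_nonsing_inv _ (by rwa [det_transpose]),
        Matrix.one_mul, nonsing_inv_mul _ hu]
    rw [dotProduct_comm, dotProduct_mulVec, dotProduct_comm, ← mulVec_transpose, mulVec_mulVec,
      mulVec_mulVec, h, one_mulVec]
    simp [dotProduct, sq]
  rw [lintegral_comp_mulVec hM hf]
  simp only [e]
  rw [lintegral_truncPow_one_sub_sum_sq n hb, ← ENNReal.ofReal_mul (abs_nonneg _), det_mul,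
    det_transpose, Real.sqrt_mul_self_eq_abs]

/-! ### Bordering a correlation matrix by one row. -/

/-- Positions below the diagonal of an `(N + 1) × (N + 1)` matrix are those of its leading
`N × N` block together with the last row. -/
noncomputable def lowerIndexSuccEquiv (N : ℕ) : LowerIndex N ⊕ Fin N ≃ LowerIndex (N + 1) :=
  Equiv.ofBijective
    (Sum.elim
      (fun p => ⟨(p.1.1.castSucc, p.1.2.castSucc), Fin.castSucc_lt_castSucc_iff.2 p.2⟩)
      (fun k => ⟨(Fin.last N, k.castSucc), Fin.castSucc_lt_last k⟩)) <| by
    constructor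
    · rintro (⟨⟨j, k⟩, h⟩ | k) (⟨⟨j', k'⟩, h'⟩ | k') he
      · simpa using he
      · simp [Fin.castSucc_ne_last] at he
      · simp [(Fin.castSucc_ne_last _).symm] at he
      · simpa using he
    · rintro ⟨⟨j, k⟩, h⟩
      have hk : k ≠ Fin.last N := (h.trans_le (Fin.le_last j)).ne
      obtain ⟨k, rfl⟩ := Fin.exists_castSucc_eq.2 hk
      by_cases hj : j = Fin.last N
      · exact ⟨.inr k, by simp [hj]⟩
      · obtain ⟨j, rfl⟩ := Fin.exists_castSucc_eq.2 hj
        exact ⟨.inl ⟨(j, k), Fin.castSucc_lt_castSucc_iff.1 h⟩, rfl⟩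

/-- Appending a last row to the coordinates of a correlation matrix. -/
noncomputable def appendRow (N : ℕ) : (LowerIndex N → ℝ) × (Fin N → ℝ) ≃ᵐ (LowerIndex (N + 1) → ℝ) :=
  (MeasurableEquiv.sumPiEquivProdPi fun _ : LowerIndex N ⊕ Fin N => ℝ).symm.trans
    (MeasurableEquiv.piCongrLeft (fun _ : LowerIndex (N + 1) => ℝ) (lowerIndexSuccEquiv N))

theorem measurePreserving_appendRow (N : ℕ) : MeasurePreserving (appendRow N) :=
  (volume_measurePreserving_sumPiEquivProdPi_symm _).trans
    (volume_measurePreserving_piCongrLeft _ _)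

theorem appendRow_castSucc {N : ℕ} (ρ : LowerIndex N → ℝ) (r : Fin N → ℝ) {j k : Fin N}
    (h : k < j) (h' : k.castSucc < j.castSucc) :
    appendRow N (ρ, r) ⟨(j.castSucc, k.castSucc), h'⟩ = ρ ⟨(j, k), h⟩ :=
  Equiv.piCongrLeft_apply_apply (fun _ : LowerIndex (N + 1) => ℝ) (lowerIndexSuccEquiv N)
    ((MeasurableEquiv.sumPiEquivProdPi fun _ : LowerIndex N ⊕ Fin N => ℝ).symm (ρ, r))
    (.inl ⟨(j, k), h⟩)

theorem appendRow_last {N : ℕ} (ρ : LowerIndex N → ℝ) (r : Fin N → ℝ) (k : Fin N)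
    (h : k.castSucc < Fin.last N) :
    appendRow N (ρ, r) ⟨(Fin.last N, k.castSucc), h⟩ = r k :=
  Equiv.piCongrLeft_apply_apply (fun _ : LowerIndex (N + 1) => ℝ) (lowerIndexSuccEquiv N)
    ((MeasurableEquiv.sumPiEquivProdPi fun _ : LowerIndex N ⊕ Fin N => ℝ).symm (ρ, r)) (.inr k)

open Matrix in
theorem corrMatrix_appendRow {N : ℕ} (ρ : LowerIndex N → ℝ) (r : Fin N → ℝ) :
    (corrMatrix (appendRow N (ρ, r))).submatrix finSumFinEquiv finSumFinEquiv =
      fromBlocks (corrMatrix ρ) (replicateCol (Fin 1) r) (replicateCol (Fin 1) r)ᴴ 1 := by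
  have hl (i : Fin 1) : Fin.natAdd N i = Fin.last N := by ext; simp
  have hc (i : Fin N) : Fin.castAdd 1 i = i.castSucc := rfl
  ext (i | i) (j | j)
  · rcases lt_trichotomy i j with h | rfl | h
    · simp [corrMatrix, hc, h, h.not_gt, appendRow_castSucc]
    · simp [corrMatrix]
    · simp [corrMatrix, hc, h, appendRow_castSucc]
  · simp [corrMatrix, hl, hc, (Fin.castSucc_lt_last _).not_gt, Fin.castSucc_lt_last, appendRow_last]
  · simp [corrMatrix, hl, hc, Fin.castSucc_lt_last, appendRow_last]
  · simp [corrMatrix, Subsingleton.elim i j]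

open Matrix in
theorem corrMatrix_posDef_of_appendRow {N : ℕ} {ρ : LowerIndex N → ℝ} {r : Fin N → ℝ}
    (h : (corrMatrix (appendRow N (ρ, r))).PosDef) : (corrMatrix ρ).PosDef := by
  have h' := (h.submatrix finSumFinEquiv.injective).submatrix
    (Sum.inl_injective (α := Fin N) (β := Fin 1))
  rw [corrMatrix_appendRow] at h'
  exact h'

open Matrix in
theorem det_corrMatrix_appendRow {N : ℕ} {ρ : LowerIndex N → ℝ} (hρ : (corrMatrix ρ).PosDef)
    (r : Fin N → ℝ) : (corrMatrix (appendRow N (ρ, r))).det =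
      (corrMatrix ρ).det * (1 - r ⬝ᵥ (corrMatrix ρ)⁻¹ *ᵥ r) := by
  have := hρ.isUnit.invertible
  rw [← det_submatrix_equiv_self finSumFinEquiv, corrMatrix_appendRow, det_fromBlocks₁₁,
    det_fin_one, invOf_eq_nonsing_inv, Matrix.mul_assoc]
  simp [Matrix.mul_apply, mulVec, dotProduct]

open Matrix in
theorem corrMatrix_appendRow_posDef_iff {N : ℕ} {ρ : LowerIndex N → ℝ}
    (hρ : (corrMatrix ρ).PosDef) (r : Fin N → ℝ) :
    (corrMatrix (appendRow N (ρ, r))).PosDef ↔ 0 < (corrMatrix (appendRow N (ρ, r))).det := by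
  refine ⟨fun h => h.det_pos, fun h => ?_⟩
  have := hρ.isUnit.invertible
  -- The Schur criterion gives semidefiniteness, and the nonzero determinant upgrades it to
  -- definiteness.
  refine (PosSemidef.posDef_iff_det_ne_zero ?_).2 h.ne'
  rw [← posSemidef_submatrix_equiv finSumFinEquiv, corrMatrix_appendRow,
    PosDef.fromBlocks₁₁ _ _ hρ]
  rw [det_corrMatrix_appendRow hρ, mul_pos_iff_of_pos_left hρ.det_pos] at h
  have e : (1 : Matrix (Fin 1) (Fin 1) ℝ) - (replicateCol (Fin 1) r)ᴴ * (corrMatrix ρ)⁻¹ *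
      replicateCol (Fin 1) r = diagonal fun _ => 1 - r ⬝ᵥ (corrMatrix ρ)⁻¹ *ᵥ r := by
    ext i j
    rw [Matrix.mul_assoc, Subsingleton.elim i j]
    simp [Matrix.mul_apply, mulVec, dotProduct]
  rw [e]
  exact PosSemidef.diagonal fun _ => h.le

theorem continuous_corrMatrix (N : ℕ) : Continuous (corrMatrix (N := N)) := by
  refine continuous_matrix fun i j => ?_
  simp only [corrMatrix, Matrix.of_apply]
  split_ifs <;> fun_prop

theorem measurable_det_corrMatrix (N : ℕ) :
    Measurable fun ρ : LowerIndex N → ℝ => (corrMatrix ρ).det :=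
  (continuous_corrMatrix N).matrix_det.measurable

theorem appendRow_mem_elliptope_iff {N : ℕ} (ρ : LowerIndex N → ℝ) (r : Fin N → ℝ) :
    appendRow N (ρ, r) ∈ elliptope (N + 1) ↔
      ρ ∈ elliptope N ∧ 0 < (corrMatrix (appendRow N (ρ, r))).det :=
  ⟨fun h => ⟨corrMatrix_posDef_of_appendRow h, h.det_pos⟩,
    fun h => (corrMatrix_appendRow_posDef_iff h.1 r).2 h.2⟩

theorem elliptope_zero : elliptope 0 = Set.univ :=
  Set.eq_univ_of_forall fun _ => Matrix.posDef_iff_dotProduct_mulVec.2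
    ⟨Matrix.ext fun i => i.elim0, fun _ hx => (hx (Subsingleton.elim _ _)).elim⟩

theorem measurableSet_elliptope (N : ℕ) : MeasurableSet (elliptope N) := by
  induction N with
  | zero =>
    rw [elliptope_zero]
    exact MeasurableSet.univ
  | succ N ih =>
    rw [← (appendRow N).measurableSet_preimage]
    convert (ih.preimage measurable_fst).inter (measurableSet_lt measurable_const
      ((measurable_det_corrMatrix (N + 1)).comp (appendRow N).measurable)) using 1
    ext ⟨ρ, r⟩
    exact appendRow_mem_elliptope_iff ρ r

/-! ### The normalising integral. -/

/-- The closed form of the integral of `(det R) ^ b` over correlation matrices. -/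
noncomputable def corrBeta (N : ℕ) (b : ℝ) : ℝ :=
  ∏ j ∈ Finset.range N, ProbabilityTheory.beta (b + ((j : ℝ) + 1) / 2) (1 / 2) ^ j

theorem corrBeta_pos (N : ℕ) {b : ℝ} (hb : -1 < b) : 0 < corrBeta N b := by
  refine Finset.prod_pos fun j _ => ?_
  -- At j = 0 the beta argument b + 1/2 may be nonpositive, but the exponent 0 makes the factor 1.
  rcases j.eq_zero_or_pos with rfl | hj
  · simp
  · have : (1 : ℝ) ≤ j := by exact_mod_cast hj
    exact pow_pos (ProbabilityTheory.beta_pos (by linarith) (by norm_num)) j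

/-- Shifting b by 1/2 moves factor j to the argument of factor j + 1, and `ballBeta` supplies the
one missing power. -/
theorem corrBeta_succ (N : ℕ) (b : ℝ) :
    corrBeta (N + 1) b = corrBeta N (b + 1 / 2) * ballBeta N b := by
  rw [corrBeta, Finset.prod_range_succ', corrBeta, ballBeta, ← Finset.prod_mul_distrib, pow_zero,
    mul_one]
  refine Finset.prod_congr rfl fun j _ => ?_
  rw [pow_succ]
  have e : b + 1 / 2 + ((j : ℝ) + 1) / 2 = b + 1 + (j : ℝ) / 2 := by ring
  have e' : b + (((j + 1 : ℕ) : ℝ) + 1) / 2 = b + 1 + (j : ℝ) / 2 := by push_cast; ring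
  rw [e, e']

theorem lintegral_elliptope_truncPow_det (N : ℕ) {b : ℝ} (hb : -1 < b) :
    ∫⁻ ρ in elliptope N, truncPow b (corrMatrix ρ).det = ENNReal.ofReal (corrBeta N b) := by
  induction N generalizing b with
  | zero =>
    simp [elliptope_zero, corrBeta, truncPow, volume_pi]
  | succ N ih =>
    have hm : Measurable ((elliptope (N + 1)).indicator fun ρ => truncPow b (corrMatrix ρ).det) :=
      ((measurable_truncPow b).comp (measurable_det_corrMatrix _)).indicator
        (measurableSet_elliptope _)
    rw [← lintegral_indicator (measurableSet_elliptope _),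
      ← (measurePreserving_appendRow N).lintegral_comp hm, Measure.volume_eq_prod,
      lintegral_prod _ (by exact (hm.comp (appendRow N).measurable).aemeasurable)]
    have key (ρ : LowerIndex N → ℝ) :
        ∫⁻ r, (elliptope (N + 1)).indicator (fun ρ => truncPow b (corrMatrix ρ).det)
            (appendRow N (ρ, r)) =
          (elliptope N).indicator (fun ρ => truncPow (b + 1 / 2) (corrMatrix ρ).det) ρ *
            ENNReal.ofReal (ballBeta N b) := by
      by_cases hρ : ρ ∈ elliptope N
      · have hd : 0 < (corrMatrix ρ).det := Matrix.PosDef.det_pos hρ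
        have e (r : Fin N → ℝ) :
            (elliptope (N + 1)).indicator (fun ρ => truncPow b (corrMatrix ρ).det)
              (appendRow N (ρ, r)) = ENNReal.ofReal ((corrMatrix ρ).det ^ b) *
                truncPow b (1 - r ⬝ᵥ ((corrMatrix ρ)⁻¹.mulVec r)) := by
          rw [← truncPow_mul b hd, ← det_corrMatrix_appendRow hρ]
          by_cases h : 0 < (corrMatrix (appendRow N (ρ, r))).det
          · rw [Set.indicator_of_mem ((appendRow_mem_elliptope_iff ρ r).2 ⟨hρ, h⟩)]
          · rw [Set.indicator_of_notMem fun h' => h ((appendRow_mem_elliptope_iff ρ r).1 h').2,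
              truncPow_of_nonpos b (not_lt.1 h)]
        simp only [e]
        rw [lintegral_const_mul' _ _ ENNReal.ofReal_ne_top,
          lintegral_truncPow_one_sub_quadratic hρ hb, Set.indicator_of_mem hρ,
          truncPow_of_pos _ hd, ← ENNReal.ofReal_mul (by positivity),
          ← ENNReal.ofReal_mul (by positivity), Real.rpow_add hd, ← Real.sqrt_eq_rpow, mul_assoc]
      · have e (r : Fin N → ℝ) :
            (elliptope (N + 1)).indicator (fun ρ => truncPow b (corrMatrix ρ).det)
              (appendRow N (ρ, r)) = 0 :=
          Set.indicator_of_notMem (fun h' => hρ ((appendRow_mem_elliptope_iff ρ r).1 h').1) _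
        simp [e, hρ]
    simp only [key]
    rw [lintegral_mul_const' _ _ ENNReal.ofReal_ne_top,
      lintegral_indicator (measurableSet_elliptope _), ih (by linarith), corrBeta_succ,
      ENNReal.ofReal_mul (corrBeta_pos N (by linarith)).le]

theorem setLIntegral_elliptope_rpow_det (N : ℕ) {b : ℝ} (hb : -1 < b) :
    ∫⁻ ρ in elliptope N, ENNReal.ofReal ((corrMatrix ρ).det ^ b) =
      ENNReal.ofReal (corrBeta N b) := by
  rw [← lintegral_elliptope_truncPow_det N hb]
  exact setLIntegral_congr_fun (measurableSet_elliptope N) fun ρ hρ =>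
    (truncPow_of_pos b (Matrix.PosDef.det_pos hρ)).symm

theorem measurable_rpow_det_corrMatrix (N : ℕ) (b : ℝ) :
    Measurable fun ρ : LowerIndex N → ℝ => (corrMatrix ρ).det ^ b :=
  (measurable_det_corrMatrix N).pow_const b

theorem rpow_det_nonneg_ae (N : ℕ) (b : ℝ) :
    0 ≤ᵐ[volume.restrict (elliptope N)] fun ρ => (corrMatrix ρ).det ^ b :=
  ae_restrict_of_forall_mem (measurableSet_elliptope N) fun _ hρ =>
    Real.rpow_nonneg (Matrix.PosDef.det_pos hρ).le b

theorem integrableOn_elliptope_rpow_det (N : ℕ) {b : ℝ} (hb : -1 < b) :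
    IntegrableOn (fun ρ => (corrMatrix ρ).det ^ b) (elliptope N) := by
  refine ⟨(measurable_rpow_det_corrMatrix N b).aestronglyMeasurable, ?_⟩
  rw [hasFiniteIntegral_iff_ofReal (rpow_det_nonneg_ae N b), setLIntegral_elliptope_rpow_det N hb]
  exact ENNReal.ofReal_lt_top

theorem integral_elliptope_rpow_det (N : ℕ) {b : ℝ} (hb : -1 < b) :
    ∫ ρ in elliptope N, (corrMatrix ρ).det ^ b = corrBeta N b := by
  rw [integral_eq_lintegral_of_nonneg_ae (rpow_det_nonneg_ae N b)
    (measurable_rpow_det_corrMatrix N b).aestronglyMeasurable,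
    setLIntegral_elliptope_rpow_det N hb, ENNReal.toReal_ofReal (corrBeta_pos N hb).le]

/-! ### The probability measure and its moments. -/

theorem isProbabilityMeasure_corrMeasure (N : ℕ) {a : ℝ} (ha : -1 < a) :
    IsProbabilityMeasure (corrMeasure N a) := by
  have hC := corrBeta_pos N ha
  refine ⟨?_⟩
  rw [corrMeasure, withDensity_apply _ MeasurableSet.univ, Measure.restrict_univ, corrNorm,
    integral_elliptope_rpow_det N ha]
  simp only [ENNReal.ofReal_mul (one_div_pos.2 hC).le]
  rw [lintegral_const_mul' _ _ ENNReal.ofReal_ne_top, setLIntegral_elliptope_rpow_det N ha,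
    ← ENNReal.ofReal_mul (one_div_pos.2 hC).le, one_div_mul_cancel hC.ne', ENNReal.ofReal_one]

theorem measurable_corrDensity (N : ℕ) (a : ℝ) :
    Measurable fun ρ : LowerIndex N → ℝ =>
      ENNReal.ofReal (1 / corrNorm N a * (corrMatrix ρ).det ^ a) :=
  ((measurable_rpow_det_corrMatrix N a).const_mul _).ennreal_ofReal

theorem corrDensity_smul_rpow_ae (N : ℕ) {a : ℝ} (ha : -1 < a) (s : ℝ) :
    (fun ρ => (ENNReal.ofReal (1 / corrNorm N a * (corrMatrix ρ).det ^ a)).toReal •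
        (corrMatrix ρ).det ^ s) =ᵐ[volume.restrict (elliptope N)]
      fun ρ => 1 / corrBeta N a * (corrMatrix ρ).det ^ (a + s) := by
  refine ae_restrict_of_forall_mem (measurableSet_elliptope N) fun ρ hρ => ?_
  have hd := Matrix.PosDef.det_pos hρ
  have hC := corrBeta_pos N ha
  simp only
  rw [corrNorm, integral_elliptope_rpow_det N ha, ENNReal.toReal_ofReal (by positivity),
    smul_eq_mul, Real.rpow_add hd, mul_assoc]

theorem integrable_rpow_det_corrMeasure (N : ℕ) {a s : ℝ} (ha : -1 < a) (hs : -1 < a + s) :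
    Integrable (fun ρ => (corrMatrix ρ).det ^ s) (corrMeasure N a) := by
  rw [corrMeasure, integrable_withDensity_iff_integrable_smul' (measurable_corrDensity N a)
    (Filter.Eventually.of_forall fun _ => ENNReal.ofReal_lt_top),
    integrable_congr (corrDensity_smul_rpow_ae N ha s)]
  exact (integrableOn_elliptope_rpow_det N hs).const_mul _

theorem integral_rpow_det_corrMeasure (N : ℕ) {a s : ℝ} (ha : -1 < a) (hs : -1 < a + s) :
    ∫ ρ, (corrMatrix ρ).det ^ s ∂(corrMeasure N a) = corrBeta N (a + s) / corrBeta N a := by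
  rw [corrMeasure, integral_withDensity_eq_integral_toReal_smul (measurable_corrDensity N a)
    (Filter.Eventually.of_forall fun _ => ENNReal.ofReal_lt_top),
    integral_congr_ae (corrDensity_smul_rpow_ae N ha s), integral_const_mul,
    integral_elliptope_rpow_det N hs, one_div, inv_mul_eq_div]

theorem det_corrMatrix_pos_ae (N : ℕ) (a : ℝ) :
    ∀ᵐ ρ ∂(corrMeasure N a), 0 < (corrMatrix ρ).det :=
  (withDensity_absolutelyContinuous _ _).ae_le
    (ae_restrict_of_forall_mem (measurableSet_elliptope N) fun _ hρ => Matrix.PosDef.det_pos hρ)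

theorem exp_mul_log_det_ae (N : ℕ) (a s : ℝ) :
    (fun ρ => Real.exp (s * Real.log (corrMatrix ρ).det)) =ᵐ[corrMeasure N a]
      fun ρ => (corrMatrix ρ).det ^ s := by
  filter_upwards [det_corrMatrix_pos_ae N a] with ρ hρ
  rw [Real.rpow_def_of_pos hρ, mul_comm]

/-- Moments exist for all s > -1 - a, an open half-line around 0. This yields both integrability of
the logarithm and differentiability of its moment generating function at 0. -/
theorem zero_mem_interior_integrableExpSet_log_det (N : ℕ) {a : ℝ} (ha : -1 < a) :
    0 ∈ interior (ProbabilityTheory.integrableExpSet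
      (fun ρ => Real.log (corrMatrix ρ).det) (corrMeasure N a)) := by
  rw [mem_interior_iff_mem_nhds]
  filter_upwards [lt_mem_nhds (show -1 - a < 0 by linarith)] with s hs
  exact (integrable_congr (exp_mul_log_det_ae N a s)).2
    (integrable_rpow_det_corrMeasure N ha (by linarith))

/-! ### Logarithmic derivatives and the mean of the logarithm. -/

theorem hasDerivAt_Gamma_of_pos {x : ℝ} (hx : 0 < x) :
    HasDerivAt Real.Gamma (Real.Gamma x * logDeriv Real.Gamma x) x := by
  have h := (Real.differentiableAt_Gamma fun m => by
    have : (0 : ℝ) ≤ m := m.cast_nonneg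
    linarith : DifferentiableAt ℝ Real.Gamma x).hasDerivAt
  rwa [logDeriv_apply, mul_div_cancel₀ _ (Real.Gamma_pos_of_pos hx).ne']

/-- Real and complex Γ agree on the real axis, so uniqueness of the derivative along it identifies
the two. -/
theorem ofReal_logDeriv_Gamma {x : ℝ} (hx : 0 < x) :
    ((logDeriv Real.Gamma x : ℝ) : ℂ) = Complex.digamma x := by
  have hG := Real.Gamma_pos_of_pos hx
  have h1 : HasDerivAt (fun y : ℝ => (Real.Gamma y : ℂ))
      ((Real.Gamma x * logDeriv Real.Gamma x : ℝ) : ℂ) x :=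
    (hasDerivAt_Gamma_of_pos hx).ofReal_comp
  have h2 : HasDerivAt (fun y : ℝ => Complex.Gamma y) (deriv Complex.Gamma x) x :=
    (Complex.differentiableAt_Gamma _ fun m h => by
      have h' : x = -(m : ℝ) := by exact_mod_cast h
      have : (0 : ℝ) ≤ m := m.cast_nonneg
      linarith).hasDerivAt.comp_ofReal
  simp only [Complex.Gamma_ofReal] at h2
  rw [Complex.digamma_def, logDeriv_apply Complex.Gamma, ← h1.unique h2, Complex.Gamma_ofReal]
  have : (Real.Gamma x : ℂ) ≠ 0 := by exact_mod_cast hG.ne'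
  push_cast
  field_simp

theorem hasDerivAt_beta_half {x : ℝ} (hx : 0 < x) :
    HasDerivAt (fun y => ProbabilityTheory.beta y (1 / 2))
      (ProbabilityTheory.beta x (1 / 2) *
        (logDeriv Real.Gamma x - logDeriv Real.Gamma (x + 1 / 2))) x := by
  have hx' : 0 < x + 1 / 2 := by positivity
  have h := ((hasDerivAt_Gamma_of_pos hx).mul_const (Real.Gamma (1 / 2))).div
    ((hasDerivAt_Gamma_of_pos hx').comp_add_const x (1 / 2)) (Real.Gamma_pos_of_pos hx').ne'
  refine h.congr_deriv ?_
  have := (Real.Gamma_pos_of_pos hx').ne'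
  rw [ProbabilityTheory.beta]
  field_simp

theorem HasDerivAt.finsetProd_of_logDeriv {ι : Type*} (s : Finset ι) {f : ι → ℝ → ℝ} {d : ι → ℝ}
    {x : ℝ} (h : ∀ i ∈ s, HasDerivAt (f i) (f i x * d i) x) :
    HasDerivAt (fun y => ∏ i ∈ s, f i y) ((∏ i ∈ s, f i x) * ∑ i ∈ s, d i) x := by
  classical
  induction s using Finset.induction_on with
  | empty => simpa using hasDerivAt_const x (1 : ℝ)
  | insert i s hi ih =>
    simp only [Finset.prod_insert hi, Finset.sum_insert hi]
    exact ((h i (Finset.mem_insert_self i s)).mul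
      (ih fun j hj => h j (Finset.mem_insert_of_mem hj))).congr_deriv (by ring)

theorem HasDerivAt.pow_of_logDeriv {f : ℝ → ℝ} {d x : ℝ} (h : HasDerivAt f (f x * d) x) (n : ℕ) :
    HasDerivAt (fun y => f y ^ n) (f x ^ n * (n * d)) x := by
  refine (h.pow n).congr_deriv ?_
  cases n with
  | zero => simp
  | succ n => rw [Nat.add_sub_cancel, pow_succ]; ring

theorem Icc_one_pred_eq_erase (N : ℕ) : Finset.Icc 1 (N - 1) = (Finset.range N).erase 0 := by
  ext j
  simp only [Finset.mem_Icc, Finset.mem_erase, Finset.mem_range]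
  omega

theorem corrBeta_eq_prod_Icc (N : ℕ) (b : ℝ) :
    corrBeta N b = ∏ j ∈ Finset.Icc 1 (N - 1),
      ProbabilityTheory.beta (b + ((j : ℝ) + 1) / 2) (1 / 2) ^ j := by
  rw [Icc_one_pred_eq_erase, Finset.prod_erase, corrBeta]
  exact pow_zero _

theorem hasDerivAt_corrBeta (N : ℕ) {b : ℝ} (hb : -1 < b) :
    HasDerivAt (corrBeta N) (corrBeta N b * ∑ j ∈ Finset.Icc 1 (N - 1),
      (j : ℝ) * (logDeriv Real.Gamma (b + ((j : ℝ) + 1) / 2) -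
        logDeriv Real.Gamma (b + 1 + (j : ℝ) / 2))) b := by
  rw [corrBeta_eq_prod_Icc, funext (corrBeta_eq_prod_Icc N)]
  refine HasDerivAt.finsetProd_of_logDeriv _ fun j hj => ?_
  have hj' : (1 : ℝ) ≤ j := by exact_mod_cast (Finset.mem_Icc.1 hj).1
  have h := (hasDerivAt_beta_half (show 0 < b + ((j : ℝ) + 1) / 2 by linarith)).comp_add_const b
    (((j : ℝ) + 1) / 2)
  rw [show b + ((j : ℝ) + 1) / 2 + 1 / 2 = b + 1 + (j : ℝ) / 2 by ring] at h
  exact HasDerivAt.pow_of_logDeriv h j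

theorem integral_log_det_corrMeasure (N : ℕ) {a : ℝ} (ha : -1 < a) :
    ∫ ρ, Real.log (corrMatrix ρ).det ∂(corrMeasure N a) = ∑ j ∈ Finset.Icc 1 (N - 1),
      (j : ℝ) * (logDeriv Real.Gamma (a + ((j : ℝ) + 1) / 2) -
        logDeriv Real.Gamma (a + 1 + (j : ℝ) / 2)) := by
  have h1 := ProbabilityTheory.hasDerivAt_mgf (zero_mem_interior_integrableExpSet_log_det N ha)
  have h2 : HasDerivAt (fun s => corrBeta N (a + s) / corrBeta N a) _ 0 :=
    (HasDerivAt.comp_const_add a 0 (by simpa using hasDerivAt_corrBeta N ha)).div_const _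
  have e : ProbabilityTheory.mgf (fun ρ => Real.log (corrMatrix ρ).det) (corrMeasure N a)
      =ᶠ[nhds 0] fun s => corrBeta N (a + s) / corrBeta N a := by
    filter_upwards [lt_mem_nhds (show -1 - a < 0 by linarith)] with s hs
    rw [ProbabilityTheory.mgf, integral_congr_ae (exp_mul_log_det_ae N a s),
      integral_rpow_det_corrMeasure N ha (by linarith)]
  -- Two derivatives at 0 of the same germ: the mean, and the logarithmic derivative of `corrBeta N`
  -- at a.
  have h3 := h1.unique (h2.congr_of_eventuallyEq e)
  simpa [(corrBeta_pos N ha).ne'] using h3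

theorem mainTheorem5 (N : ℕ) (a : ℝ) (ha : -1 < a) :
    IsProbabilityMeasure (corrMeasure N a) ∧
    (∀ s : ℝ, -1 < a + s →
      Integrable (fun ρ => (corrMatrix ρ).det ^ s) (corrMeasure N a) ∧
      ∫ ρ, (corrMatrix ρ).det ^ s ∂(corrMeasure N a) =
        ∏ j ∈ Finset.Icc 1 (N - 1),
          (ProbabilityTheory.beta (a + s + ((j : ℝ) + 1) / 2) (1 / 2) /
            ProbabilityTheory.beta (a + ((j : ℝ) + 1) / 2) (1 / 2)) ^ j) ∧
    Integrable (fun ρ => Real.log (corrMatrix ρ).det) (corrMeasure N a) ∧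
    ((∫ ρ, Real.log (corrMatrix ρ).det ∂(corrMeasure N a) : ℝ) : ℂ) =
      ∑ j ∈ Finset.Icc 1 (N - 1),
        (j : ℂ) * (Complex.digamma ((a : ℂ) + ((j : ℂ) + 1) / 2) -
          Complex.digamma ((a : ℂ) + 1 + (j : ℂ) / 2)) := by
  refine ⟨isProbabilityMeasure_corrMeasure N ha, fun s hs =>
    ⟨integrable_rpow_det_corrMeasure N ha hs, ?_⟩,
    ProbabilityTheory.integrable_of_mem_interior_integrableExpSet
      (zero_mem_interior_integrableExpSet_log_det N ha), ?_⟩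
  · rw [integral_rpow_det_corrMeasure N ha hs, corrBeta_eq_prod_Icc, corrBeta_eq_prod_Icc,
      ← Finset.prod_div_distrib]
    exact Finset.prod_congr rfl fun j _ => (div_pow _ _ _).symm
  · rw [integral_log_det_corrMeasure N ha, Complex.ofReal_sum]
    refine Finset.sum_congr rfl fun j hj => ?_
    have hj' : (1 : ℝ) ≤ j := by exact_mod_cast (Finset.mem_Icc.1 hj).1
    rw [Complex.ofReal_mul, Complex.ofReal_sub, ofReal_logDeriv_Gamma (by linarith),
      ofReal_logDeriv_Gamma (by linarith)]
    push_cast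
    rfl
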